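/- Let $X$ and $A$ be nonempty Borel spaces (Borel subsets of Polish spaces). For each $x\in X$ let $A(x)\subset A$ be a nonempty measurable set of feasible actions, such that the graph $\{(x,a): x\in X,\ a\in A(x)\}$ is measurable in $X\times A$ and contains the graph of a measurable function $X\to A$. Let $Q(\cdot\mid x,a)$ be a stochastic kernel on $X$ given this graph, let $c$ be a measurable real-valued function on the graph, let $K\subset X$ be measurable, and let $\alpha\in(0,1)$. Put $\mathbb K=\{(x,a): x\in X\setminus K,\ a\in A(x)\}$ and assume that 1. $A(x)$ is compact for every $x\in X\setminus K$; 2. on $\mathbb K$ the cost $c$ is nonnegative, lower semicontinuous and inf-compact, i.e. $\{a\in A(x): c(x,a)\le r\}$ is compact for all $x\in X\setminus K$, $r\in\mathbb R$; 3. $Q$ is strongly Feller on $\mathbb K$: $(x,a)\mapsto\int_X g(y)\,Q(dy\mid x,a)$ is continuous and bounded on $\mathbb K$ for every bounded measurable $g:X\to\mathbb R$. Let $\Pi$ be the set of randomized Markov policies $\pi=(\varphi_i)_{i\ge0}$, where each $\varphi_i$ is a stochastic kernel on $A$ given $X$ with $\varphi_i(A(x)\mid x)=1$ for all $x$. Under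 $\pi$ and the initial state $x_0=x$, the process $(x_0,a_0,x_1,a_1,\dots)$ has the law $\mathsf P^\pi_x$ under which $a_i$ is drawn from $\varphi_i(\cdot\mid x_i)$ and $x_{i+1}$ from $Q(\cdot\mid x_i,a_i)$. Let $\tau=\inf\{i\ge0: x_i\in K\}$ (with $\inf\emptyset=\infty$), $$V(\pi,x)=\mathsf E^\pi_x\Big[\sum_{i=0}^{\tau-1}\alpha^i c(x_i,a_i)\Big]\in[0,\infty],\qquad V^\star(x)=\inf_{\pi\in\Pi}V(\pi,x),$$ and call $\pi$ $\alpha$-discount optimal if $V(\pi,x)=V^\star(x)$ for all $x$. A selector is a measurable function $f$ with $f(x)\in A(x)$ for all $x$; $f^\infty$ denotes the deterministic stationary policy that plays $f(x_i)$ at every stage $i$. (The values of policies and selectors on $K$ do not affect the cost.) Let $v_0=0$ and, for $n\ge1$ and $x\in X\setminus K$, $$v_n(x)=\inf_{a\in A(x)}\Big[c(x,a)+\alpha\int_{X\setminus K}v_{n-1}(y)\,Q(dy\mid x,a)\Big].$$ Then: (i) $V^\star$ is the minimal measurable solution $\xi:X\setminus K\to[0,\infty]$ of the $\alpha$-discounted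 cost optimality equation $$\xi(x)=\min_{a\in A(x)}\Big[c(x,a)+\alpha\int_{X\setminus K}\xi(y)\,Q(dy\mid x,a)\Big]\qquad\text{for all }x\in X\setminus K ;$$ that is, $V^\star$ restricted to $X\setminus K$ is measurable and solves it (with the minimum attained), and every measurable solution $\xi:X\setminus K\to[0,\infty]$ satisfies $V^\star\le\xi$ on $X\setminus K$. (ii) There is a selector $f_\star$ that attains the minimum, i.e. $$V^\star(x)=c(x,f_\star(x))+\alpha\int_{X\setminus K}V^\star(y)\,Q(dy\mid x,f_\star(x))\qquad\text{for all }x\in X\setminus K,\tag{$*$}$$ and whose stationary policy $f_\star^\infty$ is $\alpha$-discount optimal. Conversely, if $f_\star$ is a selector such that $f_\star^\infty$ is $\alpha$-discount optimal, then $f_\star$ satisfies $(*)$. (iii) On $X\setminus K$ the functions $v_n$ are measurable, the infima defining $v_n$ ($n\ge1$) are attained, and $v_n(x)$ is nondecreasing in $n$ and converges to $V^\star(x)$ for every $x\in X\setminus K$. -/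

import Mathlib

open MeasureTheory ProbabilityTheory Filter Topology
open scoped ENNReal

/-- A Markov control model `(X, A, {A(x)}, Q, c)`: nonempty measurable sets `A(x) = feas x` of
feasible actions whose graph is measurable, a stochastic kernel `Q` on `X` given the graph, and a
measurable real-valued cost-per-stage `c` on the graph. -/
structure MarkovControlModel (X A : Type*) [MeasurableSpace X] [MeasurableSpace A] where
  feas : X → Set A
  feas_nonempty : ∀ x, (feas x).Nonempty
  measurableSet_feas : ∀ x, MeasurableSet (feas x)
  measurableSet_graph : MeasurableSet {p : X × A | p.2 ∈ feas p.1}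
  Q : Kernel {p : X × A | p.2 ∈ feas p.1} X
  isMarkovKernel_Q : IsMarkovKernel Q
  c : {p : X × A | p.2 ∈ feas p.1} → ℝ
  measurable_c : Measurable c

attribute [instance] MarkovControlModel.isMarkovKernel_Q

namespace MarkovControlModel

noncomputable section

variable {X A : Type*} [MeasurableSpace X] [MeasurableSpace A] (M : MarkovControlModel X A)

/-- All feasible state-action pairs. -/
abbrev graph : Set (X × A) := {p : X × A | p.2 ∈ M.feas p.1}

/-- The feasible pair `(x, a)`, for `a ∈ A(x)`. -/
def pair (x : X) (a : M.feas x) : M.graph := ⟨(x, (a : A)), a.2⟩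

/-- The feasible state-action pairs whose state lies outside the target set `K`. -/
def offTarget (K : Set X) : Set M.graph := {p | (p : X × A).1 ∉ K}

/-- Stochastic kernels `φ` on `A` given `X` with `φ(A(x) | x) = 1` for every `x`. -/
structure ActionKernel where
  toKernel : Kernel X A
  isMarkovKernel : IsMarkovKernel toKernel
  feasible : ∀ x, toKernel x (M.feas x) = 1

attribute [instance] ActionKernel.isMarkovKernel

/-- Randomized Markov policies `(φ₀, φ₁, …)`. -/
abbrev Policy := ℕ → M.ActionKernel

/-- Measurable functions `f : X → A` with `f x ∈ A(x)` for every `x`. -/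
structure Selector where
  toFun : X → A
  measurable : Measurable toFun
  feasible : ∀ x, toFun x ∈ M.feas x

variable {M}

/-- The value of a selector, as an element of `A(x)`. -/
def Selector.act (f : M.Selector) (x : X) : M.feas x := ⟨f.toFun x, f.feasible x⟩

/-- The deterministic stationary policy `(f, f, …)`: always play `f x` in state `x`. -/
def Selector.stationary (f : M.Selector) : M.Policy := fun _ =>
  { toKernel := Kernel.deterministic f.toFun f.measurable
    isMarkovKernel := inferInstance
    feasible := fun x => by
      rw [Kernel.deterministic_apply, Measure.dirac_apply' _ (M.measurableSet_feas x)]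
      simp [f.feasible x] }

/-- From the state `x` draw an action `a` from `φ(· | x)` and return the feasible pair `(x, a)`. -/
def ActionKernel.toPair (φ : M.ActionKernel) : Kernel X M.graph :=
  (Kernel.id ×ₖ φ.toKernel).comapRight (MeasurableEmbedding.subtype_coe M.measurableSet_graph)

instance ActionKernel.isMarkovKernel_toPair (φ : M.ActionKernel) : IsMarkovKernel φ.toPair := by
  refine Kernel.IsMarkovKernel.comapRight _ _ fun x => ?_
  rw [Subtype.range_coe, Kernel.prod_apply, Kernel.id_apply,
    Measure.prod_apply M.measurableSet_graph,
    lintegral_dirac' _ (measurable_measure_prodMk_left M.measurableSet_graph)]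
  exact φ.feasible x

variable (M) in
/-- Given the history `(x₀, a₀, …, xₙ, aₙ)`, draw `xₙ₊₁` from `Q(· | xₙ, aₙ)`, then `aₙ₊₁` from
`φₙ₊₁(· | xₙ₊₁)`. -/
def step (π : M.Policy) (n : ℕ) : Kernel (Finset.Iic n → M.graph) M.graph :=
  (π (n + 1)).toPair ∘ₖ
    M.Q.comap (fun h => h ⟨n, Finset.mem_Iic.2 le_rfl⟩) (measurable_pi_apply _)

instance isMarkovKernel_step (π : M.Policy) (n : ℕ) : IsMarkovKernel (M.step π n) := by
  unfold step; infer_instance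

variable (M)

/-- The law of the trajectory `(x₀, a₀, x₁, a₁, …)` under the policy `π` from the initial state
`x`, as given by the Ionescu-Tulcea theorem. -/
def law (π : M.Policy) (x : X) : Measure (ℕ → M.graph) :=
  Kernel.trajMeasure (X := fun _ => M.graph) ((π 0).toPair x) (M.step π)

/-- The hitting time `τ = inf {i | xᵢ ∈ K}`, equal to `∞` if `K` is never reached. -/
def hitTime (K : Set X) (ω : ℕ → M.graph) : ℕ∞ :=
  sInf ((fun i : ℕ => (i : ℕ∞)) '' {i : ℕ | (ω i : X × A).1 ∈ K})

/-- The `α`-discounted cost `V(π, x) = E [∑_{i < τ} αⁱ c(xᵢ, aᵢ)]`, an extended nonnegative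
number (used for costs that are nonnegative outside `K`). -/
def cost (K : Set X) (α : ℝ) (π : M.Policy) (x : X) : ℝ≥0∞ :=
  ∫⁻ ω, ∑' i : ℕ, (if (i : ℕ∞) < M.hitTime K ω then ENNReal.ofReal (α ^ i * M.c (ω i)) else 0)
    ∂(M.law π x)

/-- The `α`-discount value function `V*(x) = inf_π V(π, x)`. -/
def value (K : Set X) (α : ℝ) (x : X) : ℝ≥0∞ := ⨅ π : M.Policy, M.cost K α π x

/-- The policy `π` attains the infimum defining `V*` at every initial state. -/
def IsOptimal (K : Set X) (α : ℝ) (π : M.Policy) : Prop :=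
  ∀ x, M.cost K α π x = M.value K α x

/-- `c(x, a) + α ∫_{X ∖ K} u(y) Q(dy | x, a)`. -/
def oneStep (K : Set X) (α : ℝ) (u : X → ℝ≥0∞) (x : X) (a : M.feas x) : ℝ≥0∞ :=
  ENNReal.ofReal (M.c (M.pair x a)) + ENNReal.ofReal α * ∫⁻ y in Kᶜ, u y ∂(M.Q (M.pair x a))

/-- `u` restricted to `X ∖ K` is a measurable function with values in `[0, ∞]` which satisfies
`u(x) = min_{a ∈ A(x)} [c(x, a) + α ∫_{X ∖ K} u(y) Q(dy | x, a)]` for every `x ∈ X ∖ K`, the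
minimum being attained. The values of `u` on `K` play no role. -/
def SolvesDCOE (K : Set X) (α : ℝ) (u : X → ℝ≥0∞) : Prop :=
  Measurable (Kᶜ.domRestrict u) ∧
    ∀ x, x ∉ K → IsLeast (Set.range (M.oneStep K α u x)) (u x)

/-- The value-iteration functions `v₀ = 0`,
`vₙ₊₁(x) = inf_{a ∈ A(x)} [c(x, a) + α ∫_{X ∖ K} vₙ(y) Q(dy | x, a)]`, of interest on `X ∖ K`. -/
def valueIter (K : Set X) (α : ℝ) : ℕ → X → ℝ≥0∞
  | 0 => fun _ => 0
  | n + 1 => fun x => ⨅ a : M.feas x, M.oneStep K α (valueIter K α n) x a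

/-- The standing assumption: there is a measurable selector; and, outside the target set `K`, the
action sets are compact, the cost is nonnegative, lower semicontinuous and inf-compact, and `Q` is
strongly Feller. -/
structure StandingAssumption [TopologicalSpace X] [TopologicalSpace A] (K : Set X) : Prop where
  exists_selector : Nonempty M.Selector
  isCompact_feas : ∀ x, x ∉ K → IsCompact (M.feas x)
  cost_nonneg : ∀ p ∈ M.offTarget K, 0 ≤ M.c p
  cost_lsc : LowerSemicontinuousOn M.c (M.offTarget K)
  cost_infCompact : ∀ x, x ∉ K → ∀ r : ℝ,
    IsCompact {a : A | ∃ h : a ∈ M.feas x, M.c (M.pair x ⟨a, h⟩) ≤ r}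
  stronglyFeller : ∀ g : X → ℝ, Measurable g → (∃ C : ℝ, ∀ y, |g y| ≤ C) →
    ContinuousOn (fun p : M.graph => ∫ y, g y ∂(M.Q p)) (M.offTarget K) ∧
      ∃ C : ℝ, ∀ p ∈ M.offTarget K, |∫ y, g y ∂(M.Q p)| ≤ C

end

end MarkovControlModel

/-! Off `K`, let `T u (x)` be the minimum over `a` of the one-step cost with continuation `u`. The
supremum `U` of the value iterates is squeezed against the value function. Every policy costs at
least its first `n` stages, hence at least `v_n` (`le_cost_of_le_oneStep`), so `U ≤ V*`. Conversely,
one-step costs are lower semicontinuous on compact action sets, so nested sublevel sets have a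
common point (`exists_forall_oneStep_le`); this yields a selector `f` whose one-step cost with
continuation `U` is at most `U`. Iterating that inequality shows that `f` costs at most `U`
(`cost_stationary_le_of_oneStep_le`), so `V* = U` and `f` is optimal. The same iteration, applied to
any solution, gives minimality. Equation (*) for an optimal stationary policy comes from splitting
off its first stage (`cost_stationary_eq_oneStep`).

The delicate point is measurability: `x ↦ A(x)` has a measurable graph but no continuity. Both the
measurability of the iterates and the choice of selectors rest on the fact that a Borel set with
compact sections has a Borel projection and a Borel uniformization, derived here from Novikov
separation. -/

section DescriptiveSetTheory

/-! ### Separation of analytic sets, Borel projections and uniformization -/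

/-- A sequence of sets is countably separated if the sets have measurable supersets with empty
intersection. -/
def CountablySeparable {α : Type*} [MeasurableSpace α] (s : ℕ → Set α) : Prop :=
  ∃ t : ℕ → Set α, (∀ n, MeasurableSet (t n)) ∧ (∀ n, s n ⊆ t n) ∧ ⋂ n, t n = ∅

/-- The separators of the `r j` combine by a union over `j` at the index `n₀` and an intersection
over `j` elsewhere. Contrapositively, a nonseparable sequence stays nonseparable when one of its
sets is replaced by a suitable piece. -/
theorem CountablySeparable.of_iUnion {α : Type*} [MeasurableSpace α] {s : ℕ → Set α}
    {r : ℕ → ℕ → Set α} (n₀ : ℕ) (h₀ : s n₀ ⊆ ⋃ j, r j n₀) (h : ∀ j n, n ≠ n₀ → s n ⊆ r j n)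
    (hr : ∀ j, CountablySeparable (r j)) : CountablySeparable s := by
  choose t ht hrt hte using hr
  refine ⟨fun n => if n = n₀ then ⋃ j, t j n else ⋂ j, t j n, fun n => ?_, fun n => ?_, ?_⟩
  · dsimp only
    split_ifs
    · exact MeasurableSet.iUnion fun j => ht j n
    · exact MeasurableSet.iInter fun j => ht j n
  · dsimp only
    split_ifs with hn
    · subst hn
      exact h₀.trans (Set.iUnion_mono fun j => hrt j n)
    · exact Set.subset_iInter fun j => (h j n hn).trans (hrt j n)
  · refine Set.eq_empty_iff_forall_notMem.2 fun z hz => ?_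
    rw [Set.mem_iInter] at hz
    have h1 := hz n₀
    rw [if_pos rfl, Set.mem_iUnion] at h1
    obtain ⟨j, hj⟩ := h1
    refine (Set.eq_empty_iff_forall_notMem.1 (hte j)) z (Set.mem_iInter.2 fun n => ?_)
    by_cases hn : n = n₀
    · exact hn ▸ hj
    · have h2 := hz n
      rw [if_neg hn] at h2
      exact Set.mem_iInter.1 h2 j

-- If separation failed, refining one coordinate at a time would produce a point `w` such that the
-- images of every cylinder around `w` are nonseparable. As the ranges have no common point, two of
-- the image points of `w` differ, and by continuity disjoint open sets separate the images of a
-- small cylinder.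
open PiNat in
theorem countablySeparable_range {α : Type*} [TopologicalSpace α] [T2Space α] [MeasurableSpace α]
    [OpensMeasurableSpace α] {f : ℕ → (ℕ → ℕ) → α} (hf : ∀ n, Continuous (f n))
    (h : ⋂ n, Set.range (f n) = ∅) : CountablySeparable fun n => Set.range (f n) := by
  by_contra hsep
  -- Pairing codes a sequence of points of Baire space as one point `w`; coordinate `m` of `w`
  -- matters only to the map with index `(Nat.unpair m).1`.
  let g : ℕ → (ℕ → ℕ) → α := fun n w => f n fun k => w (Nat.pair n k)
  have hg : ∀ n, Continuous (g n) := fun n => (hf n).comp (by fun_prop)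
  have hgr : ∀ n, Set.range (g n) = Set.range (f n) := by
    intro n
    refine subset_antisymm ?_ ?_
    · rintro _ ⟨w, rfl⟩
      exact ⟨_, rfl⟩
    · rintro _ ⟨x, rfl⟩
      exact ⟨fun m => x (Nat.unpair m).2, by simp [g]⟩
  have split : ∀ (m : ℕ) (w : ℕ → ℕ), ¬ CountablySeparable (fun n => g n '' cylinder w m) →
      ∃ j, ¬ CountablySeparable (fun n => g n '' cylinder (Function.update w m j) (m + 1)) := by
    intro m w
    contrapose!
    intro H
    refine CountablySeparable.of_iUnion (Nat.unpair m).1 ?_ ?_ H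
    · exact (Set.image_mono (iUnion_cylinder_update w m).ge).trans Set.image_iUnion.subset
    · rintro j n hn _ ⟨y, hy, rfl⟩
      refine ⟨Function.update y m j, ?_, ?_⟩
      · rw [mem_cylinder_iff] at hy ⊢
        intro i hi
        by_cases him : i = m
        · subst him; simp
        · simp [him, hy i (by omega)]
      · simp only [g]
        congr 1
        funext k
        rw [Function.update_of_ne]
        rintro rfl
        simp at hn
  choose! J hJ using split
  let G : ℕ → ℕ → ℕ := fun m => Nat.rec (fun _ => 0) (fun m w => Function.update w m (J m w)) m
  have hGs : ∀ m, G (m + 1) = Function.update (G m) m (J m (G m)) := fun m => rfl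
  have hbad : ∀ m, ¬ CountablySeparable (fun n => g n '' cylinder (G m) m) := by
    intro m
    induction m with
    | zero => simpa [hgr] using hsep
    | succ m ih => rw [hGs]; exact hJ m _ ih
  have hstab : ∀ i n, i + 1 ≤ n → G n i = G (i + 1) i := by
    intro i
    refine Nat.le_induction rfl fun n hn ih => ?_
    rw [hGs, Function.update_of_ne (by omega), ih]
  let w : ℕ → ℕ := fun i => G (i + 1) i
  have hw : ∀ m, cylinder w m = cylinder (G m) m := by
    intro m
    rw [← mem_cylinder_iff_eq, mem_cylinder_iff]
    intro i hi
    exact (hstab i m hi).symm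
  by_cases hall : ∀ n, g n w = g 0 w
  · refine Set.eq_empty_iff_forall_notMem.1 h (g 0 w) (Set.mem_iInter.2 fun n => ?_)
    rw [← hgr, ← hall n]
    exact Set.mem_range_self _
  · push Not at hall
    obtain ⟨n, hn⟩ := hall
    obtain ⟨u, v, hu, hv, hnu, h0v, huv⟩ := t2_separation hn
    have hmem : g n ⁻¹' u ∩ g 0 ⁻¹' v ∈ 𝓝 w :=
      inter_mem ((hg n).continuousAt.preimage_mem_nhds (hu.mem_nhds hnu))
        ((hg 0).continuousAt.preimage_mem_nhds (hv.mem_nhds h0v))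
    obtain ⟨_, ⟨x, m, rfl⟩, hxw, hx⟩ :=
      (isTopologicalBasis_cylinders fun _ : ℕ => ℕ).mem_nhds_iff.1 hmem
    rw [mem_cylinder_iff_eq.1 hxw |>.symm] at hx
    have hn0 : n ≠ 0 := by rintro rfl; exact hn rfl
    refine hbad m ⟨fun k => if k = n then u else if k = 0 then v else Set.univ, ?_, ?_, ?_⟩
    · intro k
      dsimp only
      split_ifs
      exacts [hu.measurableSet, hv.measurableSet, MeasurableSet.univ]
    · intro k
      dsimp only
      rw [← hw]
      split_ifs with h1 h2
      · subst h1
        exact Set.image_subset_iff.2 fun y hy => (hx hy).1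
      · subst h2
        exact Set.image_subset_iff.2 fun y hy => (hx hy).2
      · exact Set.subset_univ _
    · refine Set.eq_empty_iff_forall_notMem.2 fun z hz => ?_
      rw [Set.mem_iInter] at hz
      have h1 := hz n
      have h2 := hz 0
      rw [if_pos rfl] at h1
      rw [if_neg hn0.symm, if_pos rfl] at h2
      exact Set.disjoint_left.1 huv h1 h2

/-- The **Novikov separation theorem**: a sequence of analytic sets with empty intersection has
measurable supersets with empty intersection. -/
theorem countablySeparable_of_analyticSet {α : Type*} [TopologicalSpace α] [T2Space α]
    [MeasurableSpace α] [OpensMeasurableSpace α] {s : ℕ → Set α} (hs : ∀ n, AnalyticSet (s n))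
    (h : ⋂ n, s n = ∅) : CountablySeparable s := by
  by_cases he : ∃ n, s n = ∅
  · obtain ⟨n, hn⟩ := he
    refine ⟨fun k => if k = n then ∅ else Set.univ, fun k => ?_, fun k => ?_, ?_⟩
    · dsimp only
      split_ifs
      exacts [MeasurableSet.empty, MeasurableSet.univ]
    · dsimp only
      split_ifs with hk
      · rw [hk, hn]
      · exact Set.subset_univ _
    · refine Set.eq_empty_iff_forall_notMem.2 fun z hz => ?_
      simpa using Set.mem_iInter.1 hz n
  · push Not at he
    have hs' : ∀ n, ∃ f : (ℕ → ℕ) → α, Continuous f ∧ Set.range f = s n := fun n => by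
      have := hs n
      rw [AnalyticSet] at this
      exact this.resolve_left (he n).ne_empty
    choose f hf hfs using hs'
    obtain rfl : (fun n => Set.range (f n)) = s := funext hfs
    exact countablySeparable_range hf h

/-- The projection of a measurable set with closed sections along a compact factor is
measurable. -/
theorem measurableSet_image_fst_of_isClosed_section {X Z : Type*} [MeasurableSpace X]
    [StandardBorelSpace X] [TopologicalSpace Z] [PolishSpace Z] [CompactSpace Z]
    [MeasurableSpace Z] [BorelSpace Z] {B : Set (X × Z)} (hB : MeasurableSet B)
    (hc : ∀ x, IsClosed (Prod.mk x ⁻¹' B)) : MeasurableSet (Prod.fst '' B) := by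
  let := upgradeStandardBorel X
  obtain ⟨b, hbc, hb0, hb⟩ := TopologicalSpace.exists_countable_basis Z
  -- Adding `∅` makes the family nonempty, so that `ℕ` enumerates it.
  obtain ⟨V, hV⟩ : ∃ V : ℕ → Set Z, ∀ U, U ∈ b ∨ U = ∅ ↔ ∃ n, V n = U := by
    obtain ⟨V, hV⟩ := (hbc.insert ∅).exists_eq_range (Set.insert_nonempty _ _)
    refine ⟨V, fun U => ?_⟩
    rw [← Set.mem_range, ← hV, Set.mem_insert_iff, or_comm]
  have hVo : ∀ n, IsOpen (V n) := fun n => by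
    rcases (hV (V n)).2 ⟨n, rfl⟩ with h | h
    · exact hb.isOpen h
    · rw [h]; exact isOpen_empty
  -- the states whose section meets `V n`
  let P : ℕ → Set X := fun n => Prod.fst '' (B ∩ Prod.snd ⁻¹' V n)
  have hPa : ∀ n, AnalyticSet (P n) := fun n =>
    (hB.inter (measurable_snd (hVo n).measurableSet)).analyticSet_image measurable_fst
  -- As sections of `B` are closed, `Bᶜ` is the union of the boxes `(P n)ᶜ × V n`. These sets are
  -- `Bᶜ` minus the boxes: analytic, with empty intersection.
  have hWa : ∀ n, AnalyticSet (Bᶜ ∩ (Prod.fst ⁻¹' P n ∪ Prod.snd ⁻¹' (V n)ᶜ)) := by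
    intro n
    have h1 : AnalyticSet (Prod.fst ⁻¹' P n ∪ Prod.snd ⁻¹' (V n)ᶜ : Set (X × Z)) := by
      rw [Set.union_eq_iUnion]
      refine AnalyticSet.iUnion fun i => ?_
      cases i
      · exact ((hVo n).isClosed_compl.preimage continuous_snd).analyticSet
      · exact (hPa n).preimage continuous_fst
    rw [Set.inter_eq_iInter]
    refine AnalyticSet.iInter fun i => ?_
    cases i
    · exact h1
    · exact hB.compl.analyticSet
  have hcover : ∀ p ∉ B, ∃ n, p.1 ∉ P n ∧ p.2 ∈ V n := by
    rintro ⟨x, z⟩ hp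
    obtain ⟨U, hUb, hzU, hU⟩ := hb.exists_subset_of_mem_open
      (show z ∈ (Prod.mk x ⁻¹' B)ᶜ from hp) (hc x).isOpen_compl
    obtain ⟨n, rfl⟩ := (hV U).1 (Or.inl hUb)
    refine ⟨n, ?_, hzU⟩
    rintro ⟨⟨x', z'⟩, ⟨h1, h2⟩, rfl⟩
    exact hU h2 h1
  obtain ⟨t, htm, hst, hte⟩ := countablySeparable_of_analyticSet hWa (by
    refine Set.eq_empty_iff_forall_notMem.2 fun p hp => ?_
    rw [Set.mem_iInter] at hp
    obtain ⟨n, h1, h2⟩ := hcover p (hp 0).1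
    rcases (hp n).2 with h | h
    exacts [h1 h, h h2])
  -- The Borel sets `Bᶜ \ t n` still cover `Bᶜ` and lie inside the boxes, so their projections miss
  -- `P n`; Lusin separation then replaces `P n` by a Borel set `D n`.
  have hsep : ∀ n, MeasurablySeparable (P n) (Prod.fst '' (Bᶜ \ t n)) := by
    intro n
    refine (hPa n).measurablySeparable
      ((hB.compl.diff (htm n)).analyticSet_image measurable_fst) ?_
    rw [Set.disjoint_right]
    rintro _ ⟨p, ⟨hpB, hpt⟩, rfl⟩ hpP
    exact hpt (hst n ⟨hpB, Or.inl hpP⟩)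
  choose D hPD hDt hDm using hsep
  -- The section at `x` is empty iff the `V n` with `x ∉ D n` cover `Z`. By compactness finitely
  -- many suffice, and there are only countably many finite index sets.
  have hkey : (Prod.fst '' B)ᶜ
      = ⋃ s ∈ {s : Finset ℕ | ⋃ n ∈ s, V n = Set.univ}, ⋂ n ∈ s, (D n)ᶜ := by
    ext x
    simp only [Set.mem_compl_iff, Set.mem_iUnion, Set.mem_iInter, Set.mem_ofPred_eq, exists_prop]
    constructor
    · intro hx
      have hxB : ∀ z, (x, z) ∉ B := fun z hz => hx ⟨_, hz, rfl⟩
      have hcov : (Set.univ : Set Z) ⊆ ⋃ n : {n // x ∉ D n}, V n := by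
        intro z _
        have : (x, z) ∉ ⋂ n, t n := by rw [hte]; exact Set.notMem_empty _
        rw [Set.mem_iInter, not_forall] at this
        obtain ⟨n, hn⟩ := this
        refine Set.mem_iUnion.2 ⟨⟨n, fun hxD => ?_⟩, ?_⟩
        · exact Set.disjoint_left.1 (hDt n) ⟨(x, z), ⟨hxB z, hn⟩, rfl⟩ hxD
        · by_contra hz
          exact hn (hst n ⟨hxB z, Or.inr hz⟩)
      obtain ⟨s, hs⟩ := isCompact_univ.elim_finite_subcover _ (fun n => hVo _) hcov
      refine ⟨s.map (Function.Embedding.subtype _), ?_, ?_⟩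
      · refine Set.eq_univ_of_univ_subset (hs.trans (Set.iUnion₂_subset fun n hn => ?_))
        exact Set.subset_biUnion_of_mem (u := V)
          (Finset.mem_coe.2 (Finset.mem_map_of_mem (Function.Embedding.subtype _) hn))
      · intro n hn
        obtain ⟨m, -, rfl⟩ := Finset.mem_map.1 hn
        exact m.2
    · rintro ⟨s, hs, hsD⟩ ⟨⟨x', z⟩, hz, rfl⟩
      have : z ∈ ⋃ n ∈ s, V n := by rw [hs]; trivial
      simp only [Set.mem_iUnion, exists_prop] at this
      obtain ⟨n, hn, hzn⟩ := this
      exact hsD n hn (hPD n ⟨_, ⟨hz, hzn⟩, rfl⟩)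
  rw [← MeasurableSet.compl_iff, hkey]
  exact MeasurableSet.biUnion (Set.to_countable _) fun s _ =>
    Finset.measurableSet_biInter s fun n _ => (hDm n).compl

variable {X A : Type*} [MeasurableSpace X] [StandardBorelSpace X] [TopologicalSpace A]
  [TopologicalSpace.MetrizableSpace A] [SecondCountableTopology A] [MeasurableSpace A]
  [BorelSpace A] [StandardBorelSpace A]

theorem exists_isEmbedding_hilbertCube (A : Type*) [TopologicalSpace A]
    [TopologicalSpace.MetrizableSpace A] [SecondCountableTopology A] :
    ∃ e : A → ℕ → unitInterval, IsEmbedding e := by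
  let := TopologicalSpace.metrizableSpaceMetric A
  exact Metric.PiNatEmbed.exists_embedding_to_hilbert_cube

/-- The projection of a measurable set with compact sections is measurable. -/
theorem measurableSet_image_fst_of_isCompact_section {B : Set (X × A)} (hB : MeasurableSet B)
    (hc : ∀ x, IsCompact (Prod.mk x ⁻¹' B)) : MeasurableSet (Prod.fst '' B) := by
  -- The Hilbert cube serves as the compact factor: injective Borel images are Borel, and compact
  -- sections remain compact, hence closed.
  obtain ⟨e, he⟩ := exists_isEmbedding_hilbertCube A
  have hinj : Function.Injective (Prod.map (id : X → X) e) :=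
    Function.injective_id.prodMap he.injective
  have h1 : MeasurableSet (Prod.map (id : X → X) e '' B) :=
    hB.image_of_measurable_injOn (measurable_id.prodMap he.continuous.measurable) hinj.injOn
  have h2 : Prod.fst '' (Prod.map (id : X → X) e '' B) = Prod.fst '' B := by
    rw [Set.image_image]; rfl
  rw [← h2]
  refine measurableSet_image_fst_of_isClosed_section h1 fun x => ?_
  have h3 : Prod.mk x ⁻¹' (Prod.map (id : X → X) e '' B) = e '' (Prod.mk x ⁻¹' B) := by
    ext z
    simp [Prod.ext_iff]
  rw [h3]
  exact ((hc x).image he.continuous).isClosed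

/-- `C` keeps the minimizers of `g` in each section. Being a minimizer is a countable condition: `g
a ≤ q` for every rational `q` such that the section reaches a value at most `q`. -/
theorem exists_subset_forall_eq_of_isCompact_section {B : Set (X × A)} (hB : MeasurableSet B)
    (hc : ∀ x, IsCompact (Prod.mk x ⁻¹' B)) {g : A → ℝ} (hg : Continuous g) :
    ∃ C ⊆ B, MeasurableSet C ∧ (∀ x, IsCompact (Prod.mk x ⁻¹' C)) ∧ Prod.fst '' C = Prod.fst '' B ∧
      ∀ x a b, (x, a) ∈ C → (x, b) ∈ C → g a = g b := by
  let R : ℚ → Set X := fun q => Prod.fst '' (B ∩ Prod.snd ⁻¹' (g ⁻¹' Set.Iic (q : ℝ)))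
  have hR : ∀ q, MeasurableSet (R q) := fun q =>
    measurableSet_image_fst_of_isCompact_section
      (hB.inter (measurable_snd (hg.measurable measurableSet_Iic)))
      fun x => (hc x).inter_right (isClosed_Iic.preimage hg)
  have key : ∀ x a, (x, a) ∈ B → (∀ q : ℚ, x ∈ R q → g a ≤ q) → ∀ b, (x, b) ∈ B → g a ≤ g b := by
    intro x a _ ha b hb
    refine le_of_forall_gt_imp_ge_of_dense fun r hr => ?_
    obtain ⟨q, hq1, hq2⟩ := exists_rat_btwn hr
    exact (ha q ⟨(x, b), ⟨hb, hq1.le⟩, rfl⟩).trans hq2.le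
  refine ⟨B ∩ ⋂ q : ℚ, ((Prod.fst ⁻¹' R q)ᶜ ∪ Prod.snd ⁻¹' (g ⁻¹' Set.Iic (q : ℝ))),
    Set.inter_subset_left, ?_, ?_, ?_, ?_⟩
  · exact hB.inter (MeasurableSet.iInter fun q => (measurable_fst (hR q)).compl.union
      (measurable_snd (hg.measurable measurableSet_Iic)))
  · intro x
    rw [Set.preimage_inter, Set.preimage_iInter]
    refine (hc x).inter_right (isClosed_iInter fun q => ?_)
    by_cases hx : x ∈ R q
    · convert! (isClosed_Iic (a := (q : ℝ))).preimage hg using 1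
      ext a
      simp [hx]
    · convert! isClosed_univ using 1
      ext a
      simp [hx]
  · refine subset_antisymm (Set.image_mono Set.inter_subset_left) ?_
    rintro _ ⟨⟨x, a⟩, ha, rfl⟩
    obtain ⟨b, hb, hbm⟩ := (hc x).exists_isMinOn ⟨a, ha⟩ hg.continuousOn
    refine ⟨(x, b), ⟨hb, Set.mem_iInter.2 fun q => ?_⟩, rfl⟩
    by_cases hx : x ∈ R q
    · right
      obtain ⟨⟨x', a'⟩, ⟨h1, h2⟩, rfl⟩ := hx
      exact (isMinOn_iff.1 hbm a' h1).trans h2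
    · exact Or.inl hx
  · intro x a b ha hb
    have aux : ∀ {a}, (x, a) ∈ B ∩ ⋂ q : ℚ,
        ((Prod.fst ⁻¹' R q)ᶜ ∪ Prod.snd ⁻¹' (g ⁻¹' Set.Iic (q : ℝ))) →
        ∀ q : ℚ, x ∈ R q → g a ≤ q := fun h q hq =>
      (Set.mem_iInter.1 h.2 q).resolve_left fun h' => h' hq
    exact le_antisymm (key x a ha.1 (aux ha) b hb.1) (key x b hb.1 (aux hb) a ha.1)

/-- A measurable set with compact sections has a measurable uniformization. -/
theorem exists_measurable_selection_of_isCompact_section [Nonempty A] {B : Set (X × A)}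
    (hB : MeasurableSet B) (hc : ∀ x, IsCompact (Prod.mk x ⁻¹' B)) :
    ∃ f : X → A, Measurable f ∧ ∀ x ∈ Prod.fst '' B, (x, f x) ∈ B := by
  obtain ⟨e, he⟩ := exists_isEmbedding_hilbertCube A
  let S := {C : Set (X × A) // MeasurableSet C ∧ ∀ x, IsCompact (Prod.mk x ⁻¹' C)}
  have hstep : ∀ (n : ℕ) (C : S), ∃ C' : S, C'.1 ⊆ C.1 ∧ Prod.fst '' C'.1 = Prod.fst '' C.1 ∧
      ∀ x a b, (x, a) ∈ C'.1 → (x, b) ∈ C'.1 → e a n = e b n := by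
    rintro n ⟨C, hC, hCc⟩
    obtain ⟨C', h1, h2, h3, h4, h5⟩ := exists_subset_forall_eq_of_isCompact_section hC hCc
      (g := fun a => (e a n : ℝ))
      (continuous_subtype_val.comp ((continuous_apply n).comp he.continuous))
    exact ⟨⟨C', h2, h3⟩, h1, h4, fun x a b ha hb => Subtype.ext (h5 x a b ha hb)⟩
  choose N hN1 hN2 hN3 using hstep
  -- Minimizing the coordinates of `e` in turn leaves, in the limit, a single point of each nonempty
  -- section: existence by compactness, uniqueness by injectivity of `e`.
  let C : ℕ → S := fun n => Nat.rec ⟨B, hB, hc⟩ (fun n C => N n C) n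
  have hCs : ∀ n, C (n + 1) = N n (C n) := fun n => rfl
  have hfst : ∀ n, Prod.fst '' (C n).1 = Prod.fst '' B := by
    intro n
    induction n with
    | zero => rfl
    | succ n ih => rw [hCs, hN2, ih]
  let D : Set (X × A) := ⋂ n, (C n).1
  have hD : MeasurableSet D := MeasurableSet.iInter fun n => (C n).2.1
  have hDB : D ⊆ B := Set.iInter_subset (fun n => (C n).1) 0
  have huniq : ∀ x a b, (x, a) ∈ D → (x, b) ∈ D → a = b := fun x a b ha hb =>
    he.injective (funext fun n =>
      hN3 n (C n) x a b (Set.mem_iInter.1 ha (n + 1)) (Set.mem_iInter.1 hb (n + 1)))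
  have hinj : Set.InjOn Prod.fst D := by
    rintro ⟨x, a⟩ ha ⟨y, b⟩ hb (rfl : x = y)
    rw [huniq x a b ha hb]
  have hex : ∀ x ∈ Prod.fst '' B, ∃ a, (x, a) ∈ D := by
    intro x hx
    have := IsCompact.nonempty_iInter_of_sequence_nonempty_isCompact_isClosed
      (fun n => Prod.mk x ⁻¹' (C n).1) (fun n => Set.preimage_mono (hCs n ▸ hN1 n (C n)))
      (fun n => by
        rw [← hfst n] at hx
        obtain ⟨⟨x', a⟩, ha, rfl⟩ := hx
        exact ⟨a, ha⟩)
      ((C 0).2.2 x) (fun n => ((C n).2.2 x).isClosed)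
    rw [← Set.preimage_iInter] at this
    exact this
  classical
  let a₀ : A := Classical.arbitrary A
  let f : X → A := fun x => if h : ∃ a, (x, a) ∈ D then h.choose else a₀
  have hf : ∀ x, (∃ a, (x, a) ∈ D) → (x, f x) ∈ D := fun x h => by
    simp only [f, dif_pos h]
    exact h.choose_spec
  have hproj : ∀ s : Set A, MeasurableSet s → MeasurableSet (Prod.fst '' (D ∩ Prod.snd ⁻¹' s)) :=
    fun s hs => (hD.inter (measurable_snd hs)).image_of_measurable_injOn measurable_fst
      (hinj.mono Set.inter_subset_left)
  refine ⟨f, fun s hs => ?_, fun x hx => hDB (hf x (hex x hx))⟩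
  have : f ⁻¹' s = Prod.fst '' (D ∩ Prod.snd ⁻¹' s) ∪
      ((Prod.fst '' (D ∩ Prod.snd ⁻¹' Set.univ))ᶜ ∩ {_x : X | a₀ ∈ s}) := by
    ext x
    by_cases hx : ∃ a, (x, a) ∈ D
    · have hfx := hf x hx
      have h1 : x ∈ Prod.fst '' (D ∩ Prod.snd ⁻¹' Set.univ) := ⟨_, ⟨hfx, trivial⟩, rfl⟩
      constructor
      · exact fun h => Or.inl ⟨_, ⟨hfx, h⟩, rfl⟩
      · rintro (⟨⟨x', a⟩, ⟨h2, h3⟩, rfl⟩ | h2)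
        · rw [Set.mem_preimage, huniq _ _ _ hfx h2]
          exact h3
        · exact absurd h1 h2.1
    · have hfx : f x = a₀ := dif_neg hx
      have h1 : ∀ s : Set A, x ∉ Prod.fst '' (D ∩ Prod.snd ⁻¹' s) := by
        rintro s ⟨⟨x', a⟩, ⟨h2, -⟩, rfl⟩
        exact hx ⟨a, h2⟩
      rw [Set.mem_preimage, hfx]
      exact ⟨fun h => Or.inr ⟨h1 _, h⟩, fun h => (h.resolve_left (h1 _)).2⟩
  rw [this]
  exact (hproj s hs).union ((hproj _ MeasurableSet.univ).compl.inter (MeasurableSet.const _))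

end DescriptiveSetTheory

/-! ### Semicontinuity, attainment and measurable selection for one-step costs -/

namespace MarkovControlModel

section OneStep

variable {X A : Type*} [MeasurableSpace X] [MeasurableSpace A] {M : MarkovControlModel X A}
  {K : Set X} {α : ℝ} {u v : X → ℝ≥0∞}

variable (M) in
/-- The one-step cost `c(x, a) + α ∫_{X ∖ K} u(y) Q(dy | x, a)` as a function on the graph. -/
noncomputable def oneStepGraph (K : Set X) (α : ℝ) (u : X → ℝ≥0∞) (p : M.graph) : ℝ≥0∞ :=
  ENNReal.ofReal (M.c p) + ENNReal.ofReal α * ∫⁻ y in Kᶜ, u y ∂(M.Q p)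

theorem measurable_indicator_compl (hK : MeasurableSet K) (hu : Measurable (Kᶜ.domRestrict u)) :
    Measurable (Kᶜ.indicator u) := by
  refine measurable_of_restrict_of_restrict_compl hK.compl ?_ ?_
  · convert! hu using 1
    ext x
    simp
  · convert! measurable_const (a := (0 : ℝ≥0∞)) using 1
    ext x
    exact Set.indicator_of_notMem x.2 u

theorem setLIntegral_kernel_eq (hK : MeasurableSet K) (u : X → ℝ≥0∞) (μ : Measure X) :
    ∫⁻ y in Kᶜ, u y ∂μ = ∫⁻ y, Kᶜ.indicator u y ∂μ :=
  (lintegral_indicator hK.compl u).symm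

theorem oneStep_congr (hK : MeasurableSet K) (h : ∀ x, x ∉ K → u x = v x) :
    M.oneStep K α u = M.oneStep K α v := by
  funext x a
  unfold oneStep
  rw [setLIntegral_congr_fun hK.compl fun y hy => h y hy]

theorem oneStep_mono (h : ∀ x, x ∉ K → u x ≤ v x) (hK : MeasurableSet K) (x : X) (a : M.feas x) :
    M.oneStep K α u x a ≤ M.oneStep K α v x a := by
  unfold oneStep
  gcongr _ + _ * ?_
  exact setLIntegral_mono' hK.compl fun y hy => h y hy

theorem measurable_oneStepGraph (hK : MeasurableSet K) (hu : Measurable u) :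
    Measurable (M.oneStepGraph K α u) := by
  refine M.measurable_c.ennreal_ofReal.add (Measurable.const_mul ?_ _)
  simp_rw [setLIntegral_kernel_eq hK]
  exact (hu.indicator hK.compl).lintegral_kernel

variable (M) in
/-- The feasible pairs `(x, a)` with `x ∉ K` whose one-step cost is at most `v x`. -/
def sublevel (K : Set X) (α : ℝ) (u v : X → ℝ≥0∞) : Set (X × A) :=
  Subtype.val '' {p : M.graph | (p : X × A).1 ∉ K ∧ M.oneStepGraph K α u p ≤ v (p : X × A).1}

theorem mem_sublevel {x : X} {a : A} : (x, a) ∈ M.sublevel K α u v ↔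
    x ∉ K ∧ ∃ h : a ∈ M.feas x, M.oneStep K α u x ⟨a, h⟩ ≤ v x := by
  constructor
  · rintro ⟨⟨⟨x', a'⟩, hp⟩, ⟨h1, h2⟩, h3⟩
    obtain ⟨rfl, rfl⟩ := Prod.mk.inj h3
    exact ⟨h1, hp, h2⟩
  · rintro ⟨hx, h, hle⟩
    exact ⟨M.pair x ⟨a, h⟩, ⟨hx, hle⟩, rfl⟩

theorem measurableSet_sublevel (hK : MeasurableSet K) (hu : Measurable u) (hv : Measurable v) :
    MeasurableSet (M.sublevel K α u v) := by
  refine (MeasurableEmbedding.subtype_coe M.measurableSet_graph).measurableSet_image' ?_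
  have h : Measurable fun p : M.graph => (p : X × A).1 := measurable_fst.comp measurable_subtype_coe
  exact (h hK).compl.inter (measurableSet_le (measurable_oneStepGraph hK hu) (hv.comp h))

variable [TopologicalSpace X] [TopologicalSpace A]

/-- The truncations `min u n` are bounded, so their integrals are continuous by the strong Feller
property; monotone convergence writes the integral of `u` as their supremum. -/
theorem StandingAssumption.lowerSemicontinuousOn_lintegral (hM : M.StandingAssumption K)
    (hu : Measurable u) :
    LowerSemicontinuousOn (fun p => ∫⁻ y, u y ∂(M.Q p)) (M.offTarget K) := by
  have h1 : (fun p => ∫⁻ y, u y ∂(M.Q p)) =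
      fun p => ⨆ n : ℕ, ENNReal.ofReal (∫ y, (min (u y) n).toReal ∂(M.Q p)) := by
    funext p
    have h2 : ∀ y, u y = ⨆ n : ℕ, min (u y) n := fun y => by
      rw [← inf_iSup_eq, ENNReal.iSup_natCast, inf_top_eq]
    rw [lintegral_congr h2, lintegral_iSup (fun n => hu.min measurable_const) fun m n hmn y =>
      min_le_min le_rfl (by exact_mod_cast hmn)]
    refine iSup_congr fun n => ?_
    rw [integral_toReal (hu.min measurable_const).aemeasurable
      (ae_of_all _ fun y => (min_le_right _ _).trans_lt (ENNReal.natCast_lt_top n)),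
      ENNReal.ofReal_toReal]
    refine ((lintegral_mono fun y => min_le_right _ _).trans_lt ?_).ne
    simp
  rw [h1]
  refine lowerSemicontinuousOn_iSup fun n => ContinuousOn.lowerSemicontinuousOn ?_
  refine ENNReal.continuous_ofReal.comp_continuousOn (hM.stronglyFeller _
    (hu.min measurable_const).ennreal_toReal ⟨n, fun y => ?_⟩).1
  rw [abs_of_nonneg ENNReal.toReal_nonneg]
  exact ENNReal.toReal_le_of_le_ofReal n.cast_nonneg (by simp)

theorem StandingAssumption.lowerSemicontinuousOn_oneStepGraph (hM : M.StandingAssumption K)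
    (hK : MeasurableSet K) (hu : Measurable u) :
    LowerSemicontinuousOn (M.oneStepGraph K α u) (M.offTarget K) := by
  refine LowerSemicontinuousOn.add ?_ ?_
  · exact ENNReal.continuous_ofReal.comp_lowerSemicontinuousOn hM.cost_lsc ENNReal.ofReal_mono
  · simp_rw [setLIntegral_kernel_eq hK]
    exact (ENNReal.continuous_const_mul ENNReal.ofReal_ne_top).comp_lowerSemicontinuousOn
      (hM.lowerSemicontinuousOn_lintegral (hu.indicator hK.compl))
      fun a b hab => mul_le_mul_right hab _

theorem StandingAssumption.lowerSemicontinuous_oneStep (hM : M.StandingAssumption K)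
    (hK : MeasurableSet K) (hu : Measurable u) {x : X} (hx : x ∉ K) :
    LowerSemicontinuous (M.oneStep K α u x) := by
  have hc : Continuous (M.pair x) :=
    Continuous.subtype_mk (continuous_const.prodMk continuous_subtype_val) _
  rw [← lowerSemicontinuousOn_univ_iff]
  exact (hM.lowerSemicontinuousOn_oneStepGraph hK hu).comp hc.continuousOn fun a _ => hx

/-- The sublevel sets are closed in a compact space and decrease with `n`. This is what allows the
minimum over actions to be exchanged with the increasing limit. -/
theorem StandingAssumption.exists_forall_oneStep_le (hM : M.StandingAssumption K)
    (hK : MeasurableSet K) {w : ℕ → X → ℝ≥0∞} (hw : ∀ n, Measurable (w n))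
    (hmono : Monotone w) {x : X} (hx : x ∉ K) {r : ℝ≥0∞}
    (h : ∀ n, ∃ a, M.oneStep K α (w n) x a ≤ r) : ∃ a, ∀ n, M.oneStep K α (w n) x a ≤ r := by
  have : CompactSpace (M.feas x) := isCompact_iff_compactSpace.1 (hM.isCompact_feas x hx)
  have hcl : ∀ n, IsClosed {a | M.oneStep K α (w n) x a ≤ r} := fun n =>
    (hM.lowerSemicontinuous_oneStep hK (hw n) hx).isClosed_preimage r
  obtain ⟨a, ha⟩ := IsCompact.nonempty_iInter_of_sequence_nonempty_isCompact_isClosed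
    (fun n => {a | M.oneStep K α (w n) x a ≤ r})
    (fun n a ha => (oneStep_mono (fun y _ => hmono n.le_succ y) hK x a).trans ha) h
    (hcl 0).isCompact hcl
  exact ⟨a, Set.mem_iInter.1 ha⟩

theorem StandingAssumption.isLeast_oneStep (hM : M.StandingAssumption K)
    (hK : MeasurableSet K) (hu : Measurable u) {x : X} (hx : x ∉ K) :
    IsLeast (Set.range (M.oneStep K α u x)) (⨅ a, M.oneStep K α u x a) := by
  have : CompactSpace (M.feas x) := isCompact_iff_compactSpace.1 (hM.isCompact_feas x hx)
  have : Nonempty (M.feas x) := (M.feas_nonempty x).to_subtype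
  obtain ⟨a, -, ha⟩ := ((hM.lowerSemicontinuous_oneStep (α := α) hK hu
    hx).lowerSemicontinuousOn Set.univ).exists_isMinOn Set.univ_nonempty isCompact_univ
  have h : ⨅ a, M.oneStep K α u x a = M.oneStep K α u x a :=
    le_antisymm (iInf_le _ a) (le_iInf fun b => isMinOn_iff.1 ha b trivial)
  rw [h]
  refine ⟨⟨a, rfl⟩, ?_⟩
  rintro _ ⟨b, rfl⟩
  exact isMinOn_iff.1 ha b trivial

theorem StandingAssumption.isCompact_section_sublevel (hM : M.StandingAssumption K)
    (hK : MeasurableSet K) (hu : Measurable u) (x : X) :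
    IsCompact (Prod.mk x ⁻¹' M.sublevel K α u v) := by
  by_cases hx : x ∈ K
  · convert! isCompact_empty using 1
    ext a
    simp [mem_sublevel, hx]
  · have : CompactSpace (M.feas x) := isCompact_iff_compactSpace.1 (hM.isCompact_feas x hx)
    convert! ((hM.lowerSemicontinuous_oneStep (α := α) hK hu hx).isClosed_preimage
      (v x)).isCompact.image continuous_subtype_val using 1
    ext a
    simp [mem_sublevel, hx]

variable [StandardBorelSpace X] [TopologicalSpace.MetrizableSpace A] [SecondCountableTopology A]
  [BorelSpace A] [StandardBorelSpace A]

/-- Because the infimum is attained, `{inf ≤ r}` is exactly the projection of a Borel set with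
compact sections. -/
theorem StandingAssumption.measurable_iInf_oneStep (hM : M.StandingAssumption K)
    (hK : MeasurableSet K) (hu : Measurable u) :
    Measurable (Kᶜ.domRestrict fun x => ⨅ a, M.oneStep K α u x a) := by
  refine measurable_of_Iic fun r => ?_
  have h : Kᶜ.domRestrict (fun x => ⨅ a, M.oneStep K α u x a) ⁻¹' Set.Iic r =
      Subtype.val ⁻¹' (Prod.fst '' M.sublevel K α u fun _ => r) := by
    ext ⟨x, hx⟩
    constructor
    · intro h
      obtain ⟨a, ha⟩ := (hM.isLeast_oneStep (α := α) hK hu hx).1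
      exact ⟨(x, a), mem_sublevel.2 ⟨hx, a.2, ha.trans_le h⟩, rfl⟩
    · rintro ⟨⟨x', a⟩, hp, rfl⟩
      obtain ⟨-, ha, hle⟩ := mem_sublevel.1 hp
      exact (iInf_le _ _).trans hle
  rw [h]
  exact measurable_subtype_coe (measurableSet_image_fst_of_isCompact_section
    (measurableSet_sublevel hK hu measurable_const) (hM.isCompact_section_sublevel hK hu))

theorem StandingAssumption.exists_selector_oneStep_le [Nonempty A] (hM : M.StandingAssumption K)
    (hK : MeasurableSet K) (hu : Measurable u) (hv : Measurable v)
    (h : ∀ x, x ∉ K → ∃ a, M.oneStep K α u x a ≤ v x) :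
    ∃ f : M.Selector, ∀ x, x ∉ K → M.oneStep K α u x (f.act x) ≤ v x := by
  classical
  obtain ⟨g, hg, hgB⟩ := exists_measurable_selection_of_isCompact_section
    (measurableSet_sublevel (α := α) hK hu hv) (hM.isCompact_section_sublevel (α := α) hK hu)
  obtain ⟨f₀⟩ := hM.exists_selector
  have hgx : ∀ x, x ∉ K → ∃ h : g x ∈ M.feas x, M.oneStep K α u x ⟨g x, h⟩ ≤ v x := fun x hx => by
    obtain ⟨a, ha⟩ := h x hx
    exact (mem_sublevel.1 (hgB x ⟨(x, a), mem_sublevel.2 ⟨hx, a.2, ha⟩, rfl⟩)).2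
  -- The uniformization need not be feasible on `K`; the given selector `f₀` is used there.
  refine ⟨⟨K.piecewise f₀.toFun g, f₀.measurable.piecewise hK hg, fun x => ?_⟩, fun x hx => ?_⟩
  · by_cases hx : x ∈ K
    · simpa [hx] using f₀.feasible x
    · simpa [hx] using (hgx x hx).1
  · obtain ⟨h1, h2⟩ := hgx x hx
    convert! h2 using 2
    exact Subtype.ext (Set.piecewise_eq_of_notMem _ _ _ hx)

end OneStep

end MarkovControlModel

/-! ### The trajectory law and the process killed on `K` -/

namespace MarkovControlModel

section PolicyEvaluation

variable {X A : Type*} [MeasurableSpace X] [MeasurableSpace A] {M : MarkovControlModel X A}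
  {K : Set X} {α : ℝ}

theorem coe_lt_hitTime_iff {ω : ℕ → M.graph} {i : ℕ} :
    (i : ℕ∞) < M.hitTime K ω ↔ ∀ j ≤ i, (ω j : X × A).1 ∉ K := by
  unfold hitTime
  constructor
  · exact fun h j hj hjK => (h.trans_le (sInf_le ⟨j, hjK, rfl⟩)).not_ge (Nat.cast_le.2 hj)
  · intro h
    rw [← not_le]
    intro hle
    have hne : ((fun i : ℕ => (i : ℕ∞)) '' {i : ℕ | (ω i : X × A).1 ∈ K}).Nonempty := by
      rw [Set.nonempty_iff_ne_empty]
      intro he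
      simp [he] at hle
    obtain ⟨j, hj, hj'⟩ := csInf_mem hne
    rw [← hj'] at hle
    exact h j (Nat.cast_le.1 hle) hj

theorem ActionKernel.toPair_apply (φ : M.ActionKernel) (y : X) {s : Set M.graph}
    (hs : MeasurableSet s) :
    φ.toPair y s = ((Measure.dirac y).prod (φ.toKernel y)) (Subtype.val '' s) := by
  rw [ActionKernel.toPair, Kernel.comapRight_apply' _ _ _ hs, Kernel.prod_apply, Kernel.id_apply]

theorem Selector.toPair_stationary (f : M.Selector) (n : ℕ) (y : X) :
    (f.stationary n).toPair y = Measure.dirac (M.pair y (f.act y)) := by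
  ext s hs
  have h : (f.stationary n).toKernel y = Measure.dirac (f.toFun y) :=
    Kernel.deterministic_apply f.measurable y
  have hs' := (MeasurableEmbedding.subtype_coe M.measurableSet_graph).measurableSet_image' hs
  rw [ActionKernel.toPair_apply _ _ hs, h, Measure.dirac_prod_dirac, Measure.dirac_apply' _ hs,
    Measure.dirac_apply' _ hs']
  have : (y, f.toFun y) ∈ Subtype.val '' s ↔ M.pair y (f.act y) ∈ s :=
    Function.Injective.mem_set_image Subtype.val_injective (a := M.pair y (f.act y))
  by_cases hm : M.pair y (f.act y) ∈ s
  · rw [Set.indicator_of_mem hm, Set.indicator_of_mem (this.2 hm)]; rfl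
  · rw [Set.indicator_of_notMem hm, Set.indicator_of_notMem (mt this.1 hm)]

theorem ActionKernel.ae_toPair_fst [MeasurableSingletonClass X] (φ : M.ActionKernel) (y : X) :
    ∀ᵐ (p : M.graph) ∂φ.toPair y, (p : X × A).1 = y := by
  have hm : MeasurableSet {p : M.graph | (p : X × A).1 = y} :=
    (measurable_fst.comp measurable_subtype_coe) (measurableSet_singleton y)
  change φ.toPair y {p : M.graph | (p : X × A).1 = y}ᶜ = 0
  rw [ActionKernel.toPair_apply _ _ hm.compl]
  refine measure_mono_null (t := {y}ᶜ ×ˢ Set.univ) ?_ ?_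
  · rintro _ ⟨p, hp, rfl⟩
    exact ⟨hp, trivial⟩
  · rw [Measure.prod_prod]
    simp

variable (M) in
/-- The law of `xₙ` under `π` and the initial state `x`, on the event that none of `x₀, …, xₙ`
lies in `K`. -/
noncomputable def killedLaw (K : Set X) (π : M.Policy) (x : X) : ℕ → Measure X
  | 0 => (Measure.dirac x).restrict Kᶜ
  | n + 1 => (M.Q ∘ₘ ((π n).toPair ∘ₘ killedLaw K π x n)).restrict Kᶜ

variable {π : M.Policy} {x : X} {u : X → ℝ≥0∞}

theorem ae_killedLaw (hK : MeasurableSet K) (n : ℕ) : ∀ᵐ y ∂M.killedLaw K π x n, y ∉ K := by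
  cases n
  · exact ae_restrict_mem hK.compl
  · exact ae_restrict_mem hK.compl

theorem lintegral_killedLaw_zero (hK : MeasurableSet K) (hu : Measurable u) (hx : x ∉ K) :
    ∫⁻ y, u y ∂M.killedLaw K π x 0 = u x := by
  rw [killedLaw, setLIntegral_kernel_eq hK, lintegral_dirac' _ (hu.indicator hK.compl),
    Set.indicator_of_mem hx]

theorem lintegral_killedLaw_succ (hK : MeasurableSet K) (hu : Measurable u) (n : ℕ) :
    ∫⁻ y, u y ∂M.killedLaw K π x (n + 1) =
      ∫⁻ y, ∫⁻ p, ∫⁻ z in Kᶜ, u z ∂(M.Q p) ∂((π n).toPair y) ∂M.killedLaw K π x n := by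
  have hu' := hu.indicator hK.compl
  simp_rw [killedLaw, setLIntegral_kernel_eq hK]
  rw [Measure.lintegral_bind (Kernel.aemeasurable _) hu'.aemeasurable,
    Measure.lintegral_bind (Kernel.aemeasurable _) hu'.lintegral_kernel.aemeasurable]

theorem ActionKernel.lintegral_toPair_indicator [MeasurableSingletonClass X] (φ : M.ActionKernel)
    (y : X) (g : M.graph → ℝ≥0∞) :
    ∫⁻ p, (M.offTarget K).indicator g p ∂φ.toPair y =
      Kᶜ.indicator (fun y => ∫⁻ p, g p ∂φ.toPair y) y := by
  by_cases hy : y ∈ K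
  · rw [Set.indicator_of_notMem (Set.notMem_compl_iff.2 hy), ← lintegral_zero (μ := φ.toPair y)]
    exact lintegral_congr_ae ((φ.ae_toPair_fst y).mono fun p hp =>
      Set.indicator_of_notMem (show p ∉ M.offTarget K from fun h => h (hp ▸ hy)) g)
  · rw [Set.indicator_of_mem hy]
    exact lintegral_congr_ae ((φ.ae_toPair_fst y).mono fun p hp =>
      Set.indicator_of_mem (show p ∈ M.offTarget K from fun h => hy (hp ▸ h)) g)

instance isProbabilityMeasure_law (π : M.Policy) (x : X) : IsProbabilityMeasure (M.law π x) := by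
  unfold law; infer_instance

theorem map_law_zero (π : M.Policy) (x : X) :
    (M.law π x).map (fun ω => ω 0) = (π 0).toPair x := by
  have h0 : Measurable fun h : Finset.Iic 0 → M.graph => h ⟨0, Finset.mem_Iic.2 le_rfl⟩ :=
    measurable_pi_apply _
  have h : (fun ω : ℕ → M.graph => ω 0) =
      (fun h : Finset.Iic 0 → M.graph => h ⟨0, Finset.mem_Iic.2 le_rfl⟩) ∘
        Preorder.frestrictLe 0 := rfl
  rw [h, ← Measure.map_map h0 (by fun_prop), law, Kernel.trajMeasure,
    Measure.map_comp _ _ (by fun_prop), Kernel.traj_map_frestrictLe, Kernel.partialTraj_self,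
    Measure.id_comp, Measure.map_map h0 (MeasurableEquiv.measurable _)]
  exact Measure.map_id

theorem measurableSet_offTarget (hK : MeasurableSet K) : MeasurableSet (M.offTarget K) :=
  ((measurable_fst.comp measurable_subtype_coe) hK).compl

-- This is the Markov property, reducing trajectory expectations to `killedLaw`. The induction is
-- over all `g`: integrating out the last transition turns `g` at time `n + 1` into `G` at time `n`.
open Classical in
theorem lintegral_law_eq [MeasurableSingletonClass X] (hK : MeasurableSet K) (n : ℕ)
    {g : M.graph → ℝ≥0∞} (hg : Measurable g) :
    ∫⁻ ω, (if ∀ j ≤ n, (ω j : X × A).1 ∉ K then g (ω n) else 0) ∂M.law π x =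
      ∫⁻ y, ∫⁻ p, g p ∂((π n).toPair y) ∂M.killedLaw K π x n := by
  induction n generalizing g with
  | zero =>
    have hg' := hg.indicator (measurableSet_offTarget (M := M) hK)
    rw [killedLaw, setLIntegral_kernel_eq hK,
      lintegral_dirac' _ (hg.lintegral_kernel.indicator hK.compl),
      ← ActionKernel.lintegral_toPair_indicator, ← map_law_zero,
      lintegral_map hg' (measurable_pi_apply 0)]
    refine lintegral_congr fun ω => ?_
    simp [Set.indicator_apply, offTarget]
  | succ n ih =>
    have hg' := hg.indicator (measurableSet_offTarget (M := M) hK)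
    let G : M.graph → ℝ≥0∞ := fun q => ∫⁻ z in Kᶜ, ∫⁻ p, g p ∂((π (n + 1)).toPair z) ∂(M.Q q)
    have hG : Measurable G := by
      simp only [G, setLIntegral_kernel_eq hK]
      exact (hg.lintegral_kernel.indicator hK.compl).lintegral_kernel
    rw [lintegral_killedLaw_succ hK hg.lintegral_kernel, ← ih hG]
    let E : Set (Finset.Iic n → M.graph) := {h | ∀ j, (h j : X × A).1 ∉ K}
    have hE : MeasurableSet E := by
      have : E = ⋂ j, (fun h => h j) ⁻¹' M.offTarget K := by
        ext h; simp [E, offTarget]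
      rw [this]
      exact MeasurableSet.iInter fun j => measurable_pi_apply j (measurableSet_offTarget hK)
    have hEiff : ∀ ω : ℕ → M.graph,
        (∀ j ≤ n, (ω j : X × A).1 ∉ K) ↔ Preorder.frestrictLe n ω ∈ E := fun ω =>
      ⟨fun h j => h j (Finset.mem_Iic.1 j.2), fun h j hj => h ⟨j, Finset.mem_Iic.2 hj⟩⟩
    have hF : Measurable fun q : (Finset.Iic n → M.graph) × M.graph =>
        E.indicator 1 q.1 * (M.offTarget K).indicator g q.2 :=
      ((measurable_one.indicator hE).comp measurable_fst).mul (hg'.comp measurable_snd)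
    have hstep : ∀ h : Finset.Iic n → M.graph, ∫⁻ p, (M.offTarget K).indicator g p ∂M.step π n h =
        G (h ⟨n, Finset.mem_Iic.2 le_rfl⟩) := by
      intro h
      rw [step, Kernel.lintegral_comp _ _ _ hg', Kernel.comap_apply]
      simp only [G, setLIntegral_kernel_eq hK, ActionKernel.lintegral_toPair_indicator]
    -- Ionescu-Tulcea: the history up to `n` followed by one step has the joint law of the history
    -- and the next pair.
    have hmarg : (M.law π x).map (Preorder.frestrictLe n) ⊗ₘ M.step π n =
        (M.law π x).map fun ω => (Preorder.frestrictLe n ω, ω (n + 1)) :=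
      Kernel.map_frestrictLe_trajMeasure_compProd_eq_map_trajMeasure
    calc ∫⁻ ω, (if ∀ j ≤ n + 1, (ω j : X × A).1 ∉ K then g (ω (n + 1)) else 0) ∂M.law π x
        = ∫⁻ ω, E.indicator 1 (Preorder.frestrictLe n ω) *
            (M.offTarget K).indicator g (ω (n + 1)) ∂M.law π x := by
          refine lintegral_congr fun ω => ?_
          simp only [Set.indicator_apply, ← hEiff, Nat.le_succ_iff, or_imp, forall_and,
            forall_eq, offTarget, Pi.one_apply]
          split_ifs <;> simp_all
      _ = ∫⁻ q, E.indicator 1 q.1 * (M.offTarget K).indicator g q.2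
            ∂((M.law π x).map (Preorder.frestrictLe n) ⊗ₘ M.step π n) := by
          rw [hmarg, lintegral_map hF (by fun_prop)]
      _ = ∫⁻ h, E.indicator 1 h * G (h ⟨n, Finset.mem_Iic.2 le_rfl⟩)
            ∂(M.law π x).map (Preorder.frestrictLe n) := by
          have := Measure.isProbabilityMeasure_map (μ := M.law π x)
            (Preorder.measurable_frestrictLe (X := fun _ => M.graph) n).aemeasurable
          rw [Measure.lintegral_compProd hF]
          refine lintegral_congr fun h => ?_
          rw [← hstep h]
          exact lintegral_const_mul (E.indicator 1 h) hg'
      _ = _ := by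
          refine (lintegral_map ((measurable_one.indicator hE).mul
            (hG.comp (measurable_pi_apply _))) (Preorder.measurable_frestrictLe n)).trans ?_
          refine lintegral_congr fun ω => ?_
          by_cases hω : ∀ j ≤ n, (ω j : X × A).1 ∉ K
          · rw [if_pos hω]
            exact (congrArg (fun r => r * G (ω n)) (Set.indicator_of_mem ((hEiff ω).1 hω) 1)).trans (one_mul _)
          · rw [if_neg hω]
            exact (congrArg (fun r => r * G (ω n)) (Set.indicator_of_notMem (mt (hEiff ω).2 hω) 1)).trans
              (zero_mul _)

end PolicyEvaluation

end MarkovControlModel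

/-! ### Policy costs and dynamic programming inequalities -/

namespace MarkovControlModel

section DynamicProgramming

variable {X A : Type*} [MeasurableSpace X] [MeasurableSpace A] {M : MarkovControlModel X A}
  {K : Set X} {α : ℝ} {π : M.Policy} {x : X} {u : X → ℝ≥0∞}

variable (M) in
/-- The expected cost `E [αⁿ c(xₙ, aₙ); n < τ]` of stage `n`. -/
noncomputable def stageCost (K : Set X) (α : ℝ) (π : M.Policy) (x : X) (n : ℕ) : ℝ≥0∞ :=
  ENNReal.ofReal α ^ n *
    ∫⁻ y, ∫⁻ p, ENNReal.ofReal (M.c p) ∂((π n).toPair y) ∂M.killedLaw K π x n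

theorem cost_eq_tsum_stageCost [MeasurableSingletonClass X] (hK : MeasurableSet K) (hα : 0 ≤ α)
    (π : M.Policy) (x : X) : M.cost K α π x = ∑' n, M.stageCost K α π x n := by
  classical
  have hc := M.measurable_c.ennreal_ofReal
  have hm : ∀ i : ℕ, Measurable fun ω : ℕ → M.graph =>
      if ∀ j ≤ i, (ω j : X × A).1 ∉ K then ENNReal.ofReal (M.c (ω i)) else 0 := fun i => by
    refine Measurable.ite ?_ (hc.comp (measurable_pi_apply i)) measurable_const
    have : {ω : ℕ → M.graph | ∀ j ≤ i, (ω j : X × A).1 ∉ K} =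
        ⋂ j, ⋂ (_ : j ≤ i), (fun ω => ω j) ⁻¹' M.offTarget K := by
      ext ω; simp [offTarget]
    rw [this]
    exact MeasurableSet.iInter fun j => MeasurableSet.iInter fun _ =>
      measurable_pi_apply j (measurableSet_offTarget hK)
  have hterm : ∀ ω : ℕ → M.graph, ∀ i : ℕ,
      (if (i : ℕ∞) < M.hitTime K ω then ENNReal.ofReal (α ^ i * M.c (ω i)) else 0) =
      ENNReal.ofReal α ^ i *
        if ∀ j ≤ i, (ω j : X × A).1 ∉ K then ENNReal.ofReal (M.c (ω i)) else 0 := by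
    intro ω i
    simp only [coe_lt_hitTime_iff, mul_ite, mul_zero, ENNReal.ofReal_mul (pow_nonneg hα i),
      ENNReal.ofReal_pow hα]
  unfold cost
  simp_rw [hterm]
  rw [lintegral_tsum fun i => ((hm i).const_mul _).aemeasurable]
  refine tsum_congr fun i => ?_
  rw [lintegral_const_mul _ (hm i), lintegral_law_eq hK i hc, stageCost]

theorem cost_eq_zero [MeasurableSingletonClass X] (hK : MeasurableSet K) (hα : 0 ≤ α)
    (π : M.Policy) (hx : x ∈ K) : M.cost K α π x = 0 := by
  have h : ∀ n, M.killedLaw K π x n = 0 := by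
    intro n
    induction n with
    | zero => simp [killedLaw, Measure.restrict_eq_zero, hx, hK.compl]
    | succ n ih => simp [killedLaw, ih]
  simp [cost_eq_tsum_stageCost hK hα, stageCost, h]

/-- Integrating the one-step cost against the law of stage `n`. -/
theorem pow_mul_lintegral_oneStepGraph (hK : MeasurableSet K) (hu : Measurable u) (n : ℕ) :
    ENNReal.ofReal α ^ n *
      ∫⁻ y, ∫⁻ p, M.oneStepGraph K α u p ∂((π n).toPair y) ∂M.killedLaw K π x n =
    M.stageCost K α π x n +
      ENNReal.ofReal α ^ (n + 1) * ∫⁻ y, u y ∂M.killedLaw K π x (n + 1) := by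
  have hc := M.measurable_c.ennreal_ofReal
  have hQ : Measurable fun p => ∫⁻ y in Kᶜ, u y ∂(M.Q p) := by
    simp_rw [setLIntegral_kernel_eq hK]
    exact (hu.indicator hK.compl).lintegral_kernel
  simp_rw [oneStepGraph, lintegral_add_left hc, lintegral_const_mul _ hQ]
  rw [lintegral_add_left hc.lintegral_kernel, lintegral_const_mul _ hQ.lintegral_kernel,
    ← lintegral_killedLaw_succ hK hu, stageCost, mul_add, pow_succ, mul_assoc]

theorem le_cost_of_le_oneStep [MeasurableSingletonClass X] (hK : MeasurableSet K) (hα : 0 ≤ α)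
    {w : ℕ → X → ℝ≥0∞} (hw : ∀ n, Measurable (w n)) (h0 : w 0 = 0)
    (h : ∀ n y, y ∉ K → ∀ a, w (n + 1) y ≤ M.oneStep K α (w n) y a) (π : M.Policy)
    (hx : x ∉ K) (n : ℕ) : w n x ≤ M.cost K α π x := by
  -- The starting stage `i` is left free: moving to `i + 1` plays the role of shifting the
  -- nonstationary policy.
  have key : ∀ n i, ENNReal.ofReal α ^ i * ∫⁻ y, w n y ∂M.killedLaw K π x i ≤
      ∑ j ∈ Finset.range n, M.stageCost K α π x (i + j) := by
    intro n
    induction n with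
    | zero => intro i; simp [h0]
    | succ n ih =>
      intro i
      calc ENNReal.ofReal α ^ i * ∫⁻ y, w (n + 1) y ∂M.killedLaw K π x i
          ≤ ENNReal.ofReal α ^ i *
              ∫⁻ y, ∫⁻ p, M.oneStepGraph K α (w n) p ∂((π i).toPair y) ∂M.killedLaw K π x i := by
            gcongr _ * ?_
            refine lintegral_mono_ae ((ae_killedLaw hK i).mono fun y hy => ?_)
            calc w (n + 1) y = ∫⁻ _, w (n + 1) y ∂((π i).toPair y) := by simp
              _ ≤ _ := by
                refine lintegral_mono_ae (((π i).ae_toPair_fst y).mono ?_)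
                rintro ⟨⟨y', a⟩, ha⟩ (rfl : y' = y)
                exact h n y' hy ⟨a, ha⟩
        _ ≤ M.stageCost K α π x i +
              ∑ j ∈ Finset.range n, M.stageCost K α π x (i + 1 + j) := by
            rw [pow_mul_lintegral_oneStepGraph hK (hw n)]
            gcongr
            exact ih (i + 1)
        _ = _ := by
            rw [Finset.sum_range_succ', add_comm]
            simp only [add_zero]
            congr 1
            exact Finset.sum_congr rfl fun j _ => by rw [add_assoc, add_comm 1 j]
  have h1 := key n 0
  rw [pow_zero, one_mul, lintegral_killedLaw_zero hK (hw n) hx] at h1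
  rw [cost_eq_tsum_stageCost hK hα]
  refine h1.trans ?_
  simp_rw [zero_add]
  exact ENNReal.sum_le_tsum _

theorem Selector.lintegral_toPair_stationary (f : M.Selector) (n : ℕ) (y : X)
    {g : M.graph → ℝ≥0∞} (hg : Measurable g) :
    ∫⁻ p, g p ∂((f.stationary n).toPair y) = g (M.pair y (f.act y)) := by
  rw [f.toPair_stationary, lintegral_dirac' _ hg]

theorem cost_stationary_le_of_oneStep_le [MeasurableSingletonClass X] (hK : MeasurableSet K)
    (hα : 0 ≤ α) (hu : Measurable u) (f : M.Selector)
    (h : ∀ y, y ∉ K → M.oneStep K α u y (f.act y) ≤ u y) (hx : x ∉ K) :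
    M.cost K α f.stationary x ≤ u x := by
  -- A supermartingale argument: the cost so far plus the discounted mean of `u` does not increase
  -- with `n`. Dropping the nonnegative remainder gives the bound.
  have key : ∀ n, ∑ j ∈ Finset.range n, M.stageCost K α f.stationary x j +
      ENNReal.ofReal α ^ n * ∫⁻ y, u y ∂M.killedLaw K f.stationary x n ≤ u x := by
    intro n
    induction n with
    | zero => simp [lintegral_killedLaw_zero hK hu hx]
    | succ n ih =>
      refine le_trans ?_ ih
      rw [Finset.sum_range_succ, add_assoc, ← pow_mul_lintegral_oneStepGraph hK hu]
      gcongr _ + _ * ?_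
      refine lintegral_mono_ae ((ae_killedLaw hK n).mono fun y hy => ?_)
      rw [f.lintegral_toPair_stationary n y (measurable_oneStepGraph hK hu)]
      exact h y hy
  rw [cost_eq_tsum_stageCost hK hα]
  exact ENNReal.tsum_le_of_sum_range_le fun n => le_self_add.trans (key n)

/-- The operator `g ↦ ∫_{X ∖ K} g(y) Q(dy | ·, f(·))`. -/
noncomputable def Selector.transition (K : Set X) (f : M.Selector) (g : X → ℝ≥0∞) (y : X) :
    ℝ≥0∞ :=
  ∫⁻ z in Kᶜ, g z ∂(M.Q (M.pair y (f.act y)))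

theorem Selector.measurable_pair (f : M.Selector) : Measurable fun y => M.pair y (f.act y) :=
  Measurable.subtype_mk (measurable_id.prodMk f.measurable)

theorem Selector.measurable_transition (hK : MeasurableSet K) (f : M.Selector)
    {g : X → ℝ≥0∞} (hg : Measurable g) : Measurable (f.transition K g) := by
  unfold transition
  simp_rw [setLIntegral_kernel_eq hK]
  exact (hg.indicator hK.compl).lintegral_kernel.comp f.measurable_pair

/-- Under a stationary policy all stages use the same operator, so its powers let the first
transition be split off in `cost_stationary_eq_oneStep` without shifting trajectories. -/
theorem Selector.lintegral_killedLaw (hK : MeasurableSet K) (f : M.Selector) (n : ℕ)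
    {g : X → ℝ≥0∞} (hg : Measurable g) (hx : x ∉ K) :
    ∫⁻ y, g y ∂M.killedLaw K f.stationary x n = (f.transition K)^[n] g x := by
  induction n generalizing g with
  | zero => exact lintegral_killedLaw_zero hK hg hx
  | succ n ih =>
    have hQ : Measurable fun p => ∫⁻ y in Kᶜ, g y ∂(M.Q p) := by
      simp_rw [setLIntegral_kernel_eq hK]
      exact (hg.indicator hK.compl).lintegral_kernel
    rw [lintegral_killedLaw_succ hK hg, Function.iterate_succ_apply,
      ← ih (f.measurable_transition hK hg)]
    exact lintegral_congr fun y => f.lintegral_toPair_stationary n y hQ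

theorem cost_stationary_eq_oneStep [MeasurableSingletonClass X] (hK : MeasurableSet K)
    (hα : 0 ≤ α) (f : M.Selector) (hx : x ∉ K) :
    M.cost K α f.stationary x = M.oneStep K α (M.cost K α f.stationary) x (f.act x) := by
  have hc := M.measurable_c.ennreal_ofReal
  let c : X → ℝ≥0∞ := fun y => ENNReal.ofReal (M.c (M.pair y (f.act y)))
  have hcm : Measurable c := hc.comp f.measurable_pair
  have hL : ∀ n, Measurable ((f.transition K)^[n] c) := fun n => by
    induction n with
    | zero => exact hcm
    | succ n ih => rw [Function.iterate_succ_apply']; exact f.measurable_transition hK ih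
  have hV : ∀ y, y ∉ K → M.cost K α f.stationary y =
      ∑' n, ENNReal.ofReal α ^ n * (f.transition K)^[n] c y := by
    intro y hy
    rw [cost_eq_tsum_stageCost hK hα]
    refine tsum_congr fun n => ?_
    rw [stageCost, ← f.lintegral_killedLaw hK n hcm hy]
    congr 1
    exact lintegral_congr fun z => f.lintegral_toPair_stationary n z hc
  rw [oneStep_congr hK hV, hV x hx, tsum_eq_zero_add' ENNReal.summable, oneStep,
    lintegral_tsum fun n => ((hL n).const_mul _).aemeasurable, ← ENNReal.tsum_mul_left]
  congr 1
  · simp [c]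
  · refine tsum_congr fun n => ?_
    rw [lintegral_const_mul _ (hL n), Function.iterate_succ_apply', pow_succ', mul_assoc]
    rfl

end DynamicProgramming

end MarkovControlModel

/-! ### The main theorem -/

open MarkovControlModel in
/-- `X` and `A` are Borel spaces: separable metrizable spaces whose Borel σ-algebra is standard,
that is, up to homeomorphism, Borel subsets of Polish spaces. -/
theorem theorem3p1 {X A : Type*}
    [TopologicalSpace X] [TopologicalSpace.MetrizableSpace X] [SecondCountableTopology X]
    [MeasurableSpace X] [BorelSpace X] [StandardBorelSpace X] [Nonempty X]
    [TopologicalSpace A] [TopologicalSpace.MetrizableSpace A] [SecondCountableTopology A]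
    [MeasurableSpace A] [BorelSpace A] [StandardBorelSpace A] [Nonempty A]
    (M : MarkovControlModel X A) (K : Set X) (hK : MeasurableSet K)
    (α : ℝ) (hα0 : 0 < α) (hα1 : α < 1) (hM : M.StandingAssumption K) :
    -- the value function is the minimal nonnegative measurable solution of the DCOE
    (M.SolvesDCOE K α (M.value K α) ∧
      ∀ u : X → ℝ≥0∞, M.SolvesDCOE K α u → ∀ x, x ∉ K → M.value K α x ≤ u x) ∧
    -- some selector attains the minimum, and its stationary policy is optimal
    (∃ f : M.Selector,
      (∀ x, x ∉ K → M.value K α x = M.oneStep K α (M.value K α) x (f.act x)) ∧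
      M.IsOptimal K α f.stationary) ∧
    -- every optimal deterministic stationary policy attains the minimum
    (∀ f : M.Selector, M.IsOptimal K α f.stationary →
      ∀ x, x ∉ K → M.value K α x = M.oneStep K α (M.value K α) x (f.act x)) ∧
    -- the value iterations are measurable, are attained minima, and increase to the value function
    ((∀ n, Measurable (Kᶜ.domRestrict (M.valueIter K α n))) ∧
      (∀ n x, x ∉ K →
        IsLeast (Set.range (M.oneStep K α (M.valueIter K α n) x)) (M.valueIter K α (n + 1) x)) ∧
      ∀ x, x ∉ K → Monotone (fun n => M.valueIter K α n x) ∧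
        Tendsto (fun n => M.valueIter K α n x) atTop (𝓝 (M.value K α x))) := by
  set V := M.value K α
  -- The iterates are controlled only off `K`; extending them by zero makes them measurable on all
  -- of `X` without changing any one-step cost.
  set W : ℕ → X → ℝ≥0∞ := fun n => Kᶜ.indicator (M.valueIter K α n) with hWdef
  have hα := hα0.le
  have hWx : ∀ n x, x ∉ K → W n x = M.valueIter K α n x := fun n x hx =>
    Set.indicator_of_mem hx _
  have hone : ∀ n, M.oneStep K α (W n) = M.oneStep K α (M.valueIter K α n) := fun n =>
    oneStep_congr hK (hWx n)
  have hvm : ∀ n, Measurable (Kᶜ.domRestrict (M.valueIter K α n)) := by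
    intro n
    induction n with
    | zero => exact measurable_const
    | succ n ih =>
      have := hM.measurable_iInf_oneStep (α := α) hK (measurable_indicator_compl hK ih)
      rwa [hone n] at this
  have hWm : ∀ n, Measurable (W n) := fun n => measurable_indicator_compl hK (hvm n)
  have hleast : ∀ n x, x ∉ K →
      IsLeast (Set.range (M.oneStep K α (M.valueIter K α n) x)) (M.valueIter K α (n + 1) x) := by
    intro n x hx
    have := hM.isLeast_oneStep (α := α) hK (hWm n) hx
    rwa [hone n] at this
  have hvmono : Monotone (M.valueIter K α) := by
    refine monotone_nat_of_le_succ fun n => ?_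
    induction n with
    | zero => exact fun x => zero_le
    | succ n ih => exact fun x => iInf_mono fun a => oneStep_mono (fun y _ => ih y) hK x a
  have hWmono : Monotone W := fun m n hmn => Set.indicator_mono (hvmono hmn)
  have hW0 : W 0 = 0 := Set.indicator_zero _ _
  let U : X → ℝ≥0∞ := fun x => ⨆ n, W n x
  have hUm : Measurable U := Measurable.iSup hWm
  have hUV : ∀ x, x ∉ K → U x ≤ V x := fun x hx => iSup_le fun n => le_iInf fun π =>
    le_cost_of_le_oneStep hK hα hWm hW0 (fun n y hy a => by
      rw [hWx _ y hy, hone]; exact iInf_le _ a) π hx n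
  have honeU : ∀ x a, M.oneStep K α U x a = ⨆ n, M.oneStep K α (W n) x a := fun x a => by
    simp only [oneStep, U]
    rw [lintegral_iSup hWm hWmono, ENNReal.mul_iSup, ENNReal.add_iSup]
  -- For each `n` some action has one-step cost `v_{n+1}(x) ≤ U x`; compactness supplies one action
  -- good for all `n`, and monotone convergence passes to `U`.
  obtain ⟨f, hf⟩ := hM.exists_selector_oneStep_le (α := α) hK hUm hUm fun x hx => by
    obtain ⟨a, ha⟩ := hM.exists_forall_oneStep_le (α := α) hK hWm hWmono hx (r := U x) fun n => by
      obtain ⟨a, ha⟩ := (hleast n x hx).1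
      refine ⟨a, ?_⟩
      rw [hone, ha, ← hWx _ x hx]
      exact le_iSup (fun n => W n x) (n + 1)
    exact ⟨a, (honeU x a).trans_le (iSup_le ha)⟩
  have hfU : ∀ x, x ∉ K → M.cost K α f.stationary x ≤ U x := fun x hx =>
    cost_stationary_le_of_oneStep_le hK hα hUm f hf hx
  have hVle : ∀ (g : M.Selector) x, V x ≤ M.cost K α g.stationary x := fun g x => iInf_le _ _
  have hVU : ∀ x, x ∉ K → V x = U x := fun x hx =>
    le_antisymm ((hVle f x).trans (hfU x hx)) (hUV x hx)
  have hVone : M.oneStep K α V = M.oneStep K α U := oneStep_congr hK hVU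
  have hopt : M.IsOptimal K α f.stationary := fun x => by
    refine le_antisymm ?_ (hVle f x)
    by_cases hx : x ∈ K
    · rw [cost_eq_zero hK hα _ hx]; exact zero_le
    · exact (hfU x hx).trans (hUV x hx)
  have hattain : ∀ g : M.Selector, M.IsOptimal K α g.stationary →
      ∀ x, x ∉ K → V x = M.oneStep K α V x (g.act x) := fun g hg x hx => by
    have h := cost_stationary_eq_oneStep hK hα g hx
    rwa [funext hg] at h
  -- Each `v_n ≤ v_{n+1}` lies below the one-step cost of `v_n` at any action, hence below that of
  -- `U`.
  have hVlow : ∀ x, x ∉ K → ∀ a, V x ≤ M.oneStep K α V x a := fun x hx a => by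
    rw [hVU x hx, hVone]
    refine iSup_le fun n => (hWmono n.le_succ x).trans ?_
    rw [hWx _ x hx, honeU]
    refine le_trans ?_ (le_iSup _ n)
    rw [hone]
    exact iInf_le _ a
  refine ⟨⟨⟨?_, fun x hx => ⟨⟨f.act x, (hattain f hopt x hx).symm⟩, ?_⟩⟩, fun u hu x hx => ?_⟩,
    ⟨f, hattain f hopt, hopt⟩, hattain, hvm, hleast, fun x hx => ⟨fun m n hmn => hvmono hmn x, ?_⟩⟩
  · have : Kᶜ.domRestrict V = Kᶜ.domRestrict U := funext fun x => hVU x x.2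
    rw [this]
    exact hUm.comp measurable_subtype_coe
  · rintro _ ⟨a, rfl⟩
    exact hVlow x hx a
  · have hu' := measurable_indicator_compl hK hu.1
    have hux : ∀ x, x ∉ K → Kᶜ.indicator u x = u x := fun x hx => Set.indicator_of_mem hx _
    -- A selector attaining the minimum for the solution `u` has a stationary policy of cost at most
    -- `u`.
    obtain ⟨g, hg⟩ := hM.exists_selector_oneStep_le (α := α) hK hu' hu' fun y hy => by
      obtain ⟨a, ha⟩ := (hu.2 y hy).1
      exact ⟨a, by rw [oneStep_congr hK hux, hux y hy, ha]⟩
    rw [← hux x hx]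
    exact (hVle g x).trans (cost_stationary_le_of_oneStep_le hK hα hu' g hg hx)
  · rw [hVU x hx]
    have h : (fun n => M.valueIter K α n x) = fun n => W n x := funext fun n => (hWx n x hx).symm
    rw [h]
    exact tendsto_atTop_iSup fun m n hmn => hWmono hmn x
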